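/- Let $\mathcal H$ be a complex Hilbert space with orthonormal basis $\{|n\rangle\}_{n\ge 0}$ (the Fock basis of a single harmonic oscillator), with annihilation and creation operators $a|n\rangle=\sqrt n\,|n-1\rangle$, $a^\dagger|n\rangle=\sqrt{n+1}\,|n+1\rangle$. For $\alpha\in\mathbb C$ let $|\alpha\rangle=e^{-|\alpha|^2/2}\sum_{n\ge0}\frac{\alpha^n}{\sqrt{n!}}|n\rangle$ be the coherent state, and let the set $\mathcal C$ of classical states be the trace-norm closed convex hull of $\{|\alpha\rangle\langle\alpha| : \alpha\in\mathbb C\}$. For a density operator $\rho$ define the (generalized) nonclassicality robustness $$R_{\mathcal C}(\rho)=\inf\Big\{1+\lambda \;:\; \lambda\ge 0,\ \tfrac{\xi_k+\lambda\tau_k}{1+\lambda}\in\mathcal C \text{ for all } k,\ \tau_k \text{ density operators},\ \xi_k\in\mathcal B(\mathcal H),\ \|\xi_k-\rho\|_1\to 0\Big\}\in[1,\infty].$$ For $r\ge 0$ let $|\zeta_r\rangle=e^{r(a^2-a^{\dagger 2})/2}|0\rangle$ be the squeezed vacuum, i.e. the value at $t=r$ of the solution $\psi:\mathbb R\to\mathcal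 H$ of $\psi'(t)=A\psi(t)$, $\psi(0)=|0\rangle$, where $A$ is the closure of $\tfrac12(a^2-a^{\dagger2})$ defined on finite linear combinations of Fock states. Then for every $r\ge0$ the vector $|\zeta_r\rangle$ is well defined (it exists and is unique) and $$R_{\mathcal C}\big(|\zeta_r\rangle\langle\zeta_r|\big)=e^{r}.$$ -/

import Mathlib

open scoped ENNReal NNReal Topology Nat

noncomputable section

namespace SqueezedRobustness

/- The Hilbert space of a single harmonic oscillator is a complex Hilbert space `H` with an
orthonormal basis `b` indexed by `ℕ`; the Fock state `|n⟩` is `b n`. -/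
variable {H : Type*} [NormedAddCommGroup H] [InnerProductSpace ℂ H] [CompleteSpace H]

/-- The rank-one operator `|ψ⟩⟨ψ|`. -/
def proj (ψ : H) : H →L[ℂ] H := InnerProductSpace.rankOne ℂ ψ ψ

/-! ### Trace norm and density operators -/

/-- The trace norm `‖T‖₁ = Tr |T|`, where `|T| = √(T* T)`; it is `∞` if `T` is not trace class. -/
def traceNorm (b : HilbertBasis ℕ ℂ H) (T : H →L[ℂ] H) : ℝ≥0∞ :=
  ∑' n : ℕ, ENNReal.ofReal (inner ℂ (b n) (CFC.abs T (b n))).re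

/-- Density operators: positive operators of trace one. -/
def IsDensity (b : HilbertBasis ℕ ℂ H) (ρ : H →L[ℂ] H) : Prop :=
  ρ.IsPositive ∧ HasSum (fun n : ℕ => inner ℂ (b n) (ρ (b n))) (1 : ℂ)

/-- Convergence of a sequence of bounded operators in trace norm. -/
def TraceTendsto (b : HilbertBasis ℕ ℂ H) (ξ : ℕ → (H →L[ℂ] H)) (ρ : H →L[ℂ] H) : Prop :=
  Filter.Tendsto (fun k => traceNorm b (ξ k - ρ)) Filter.atTop (𝓝 0)

/-- The closure of a set of bounded operators in trace norm. -/
def traceClosure (b : HilbertBasis ℕ ℂ H) (S : Set (H →L[ℂ] H)) : Set (H →L[ℂ] H) :=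
  {σ | ∃ c : ℕ → (H →L[ℂ] H), (∀ k, c k ∈ S) ∧ TraceTendsto b c σ}

/-! ### The (generalized) robustness with respect to a set of free states -/

/-- The robustness: the infimum of `1 + lam` over `lam ≥ 0` such
that `(ξ_k + lam τ_k) / (1 + lam)` is free for all `k`, for some density operators `τ_k` and some
bounded operators `ξ_k` that converge to `ρ` in trace norm (`∞` if there is no such `lam`). -/
def robustness (b : HilbertBasis ℕ ℂ H) (F : Set (H →L[ℂ] H)) (ρ : H →L[ℂ] H) : ℝ≥0∞ :=
  sInf {x : ℝ≥0∞ | ∃ (lam : ℝ≥0) (ξ τ : ℕ → (H →L[ℂ] H)),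
    x = 1 + (lam : ℝ≥0∞) ∧ (∀ k, IsDensity b (τ k)) ∧ TraceTendsto b ξ ρ ∧
    ∀ k, (1 + (lam : ℝ))⁻¹ • (ξ k + (lam : ℝ) • τ k) ∈ F}

/-! ### Coherent states and classical states -/

/-- The coefficients `e^{-|α|²/2} αⁿ / √(n!)` of a coherent state. -/
def coherentCoeff (α : ℂ) (n : ℕ) : ℂ :=
  (Real.exp (-‖α‖ ^ 2 / 2) : ℂ) * (α ^ n / (Real.sqrt (n ! : ℝ) : ℂ))

theorem coherentCoeff_memℓp (α : ℂ) : Memℓp (coherentCoeff α) 2 := by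
  refine memℓp_gen ?_
  have h : Summable fun n : ℕ => Real.exp (-‖α‖ ^ 2 / 2) ^ 2 * ((‖α‖ ^ 2) ^ n / (n ! : ℝ)) :=
    (Real.summable_pow_div_factorial (‖α‖ ^ 2)).mul_left _
  refine h.congr fun n => ?_
  have hn : (0 : ℝ) ≤ (n ! : ℝ) := by positivity
  simp only [coherentCoeff, ENNReal.toReal_ofNat, Real.rpow_two, norm_mul, norm_div, norm_pow,
    Complex.norm_real, Real.norm_eq_abs, Real.abs_exp, abs_of_nonneg (Real.sqrt_nonneg _),
    mul_pow, div_pow, Real.sq_sqrt hn]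
  ring

/-- The coherent state `|α⟩`. -/
def coherent (b : HilbertBasis ℕ ℂ H) (α : ℂ) : H :=
  b.repr.symm ⟨coherentCoeff α, coherentCoeff_memℓp α⟩

/-- The classical states: the trace-norm closed convex hull of the coherent states. -/
def classicalStates (b : HilbertBasis ℕ ℂ H) : Set (H →L[ℂ] H) :=
  traceClosure b (convexHull ℝ (Set.range fun α : ℂ => proj (coherent b α)))

/-! ### Squeezed vacuum -/

/-- The annihilation operator on finite combinations of Fock states: `a|n⟩ = √n |n-1⟩`
(the value at `n = 0` is `0`). -/
def annihilation : (ℕ →₀ ℂ) →ₗ[ℂ] (ℕ →₀ ℂ) :=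
  Finsupp.linearCombination ℂ fun n : ℕ => Finsupp.single (n - 1) (Real.sqrt n : ℂ)

/-- The creation operator on finite combinations of Fock states: `a†|n⟩ = √(n+1) |n+1⟩`. -/
def creation : (ℕ →₀ ℂ) →ₗ[ℂ] (ℕ →₀ ℂ) :=
  Finsupp.linearCombination ℂ fun n : ℕ => Finsupp.single (n + 1) (Real.sqrt (n + 1) : ℂ)

/-- The operator `(a² - a†²) / 2` on finite combinations of Fock states. -/
def squeezeGen : (ℕ →₀ ℂ) →ₗ[ℂ] (ℕ →₀ ℂ) :=
  (1 / 2 : ℂ) • (annihilation ∘ₗ annihilation - creation ∘ₗ creation)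

/-- Finite combinations of Fock states as vectors of the Fock space. -/
def toFock (b : HilbertBasis ℕ ℂ H) : (ℕ →₀ ℂ) →ₗ[ℂ] H := Finsupp.linearCombination ℂ b

/-- The graph of the closure of the densely defined (skew-symmetric) operator
`(a² - a†²) / 2` on the Fock space. -/
def squeezeGraph (b : HilbertBasis ℕ ℂ H) : Submodule ℂ (H × H) :=
  (LinearMap.range ((toFock b).prod (toFock b ∘ₗ squeezeGen))).topologicalClosure

/-- `ψ` is the orbit `t ↦ e^{t A} v` of the one-parameter group generated by the (unbounded)
operator `A` with graph `G`: `ψ` is differentiable, lies in the domain of `A`, and solves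
`ψ'(t) = A ψ(t)`, `ψ(0) = v`. For skew-symmetric `A` such a `ψ` is unique. -/
def IsExpOrbit (G : Submodule ℂ (H × H)) (v : H) (ψ : ℝ → H) : Prop :=
  ψ 0 = v ∧ ∀ t : ℝ, ∃ w : H, (ψ t, w) ∈ G ∧ HasDerivAt ψ w t

/-- `ζ = e^{r (a² - a†²) / 2} |0⟩`, the squeezed vacuum vector with squeezing parameter `r`. -/
def IsSqueezedVacuum (b : HilbertBasis ℕ ℂ H) (r : ℝ) (ζ : H) : Prop :=
  ∃ ψ : ℝ → H, IsExpOrbit (squeezeGraph b) (b 0) ψ ∧ ψ r = ζ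

end SqueezedRobustness

end

set_option linter.unusedSectionVars false

noncomputable section

namespace SqueezedRobustness

variable {H : Type*} [NormedAddCommGroup H] [InnerProductSpace ℂ H] [CompleteSpace H]

open Filter MeasureTheory ProbabilityTheory

/-! ### Trace norm estimates -/

/-! Both bounds rest on writing the squeezed vacuum as `exp (r / 2)` times a Gaussian average `v` of
the coherent states `|i s x⟩`, with `s² = (exp (2 r) - 1) / 2` (`squeezedVacuum_eq_integral`).

Upper bound: an average of unit vectors satisfies `|v⟩⟨v| ≤ σ`, where `σ` is the same average of
their projections, because the difference is a covariance (`exists_mixture`). So the squeezed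
projection is at most `exp r` times a classical state, and the remainder supplies `lam • τ`. Finite
convex combinations tending to `v`, once normalised, serve as the approximants `ξ`.

Lower bound: the unnormalised squeezed vectors `h = squeezeSeries b (-t)`, `0 < t < 1`, have overlap
at most one with every coherent state, so `⟨h, · h⟩` is a robustness witness
(`le_robustness_of_witness`). As `t → 1` the overlap with each `|i s x⟩` tends to one, so the
witness becomes tight on the decomposition above and its value on the squeezed state tends to `exp
r`.

The vector itself is found by solving the evolution equation with an explicit series
(`squeezedVacuum_isExpOrbit`). It is unique because orbits of a skew-symmetric generator preserve
the norm, applied to the difference of two orbits. -/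

theorem ofReal_sq_norm_eq_tsum (b : HilbertBasis ℕ ℂ H) (x : H) :
    ENNReal.ofReal (‖x‖ ^ 2) = ∑' n, ENNReal.ofReal (‖inner ℂ (b n) x‖ ^ 2) := by
  have h := b.hasSum_inner_mul_inner x x
  have h2 : HasSum (fun n => ‖inner ℂ (b n) x‖ ^ 2) (‖x‖ ^ 2) := by
    have h3 := (Complex.reCLM.hasSum h)
    convert! h3 using 1
    · funext n
      simp only [Complex.reCLM_apply]
      rw [← inner_conj_symm x (b n), Complex.conj_mul', ← Complex.ofReal_pow, Complex.ofReal_re]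
    · exact (inner_self_eq_norm_sq (𝕜 := ℂ) x).symm
  rw [← h2.tsum_eq, ENNReal.ofReal_tsum_of_nonneg (fun n => by positivity) h2.summable]

theorem norm_abs_apply (T : H →L[ℂ] H) (x : H) : ‖CFC.abs T x‖ = ‖T x‖ := by
  have h1 : ‖CFC.abs T x‖ ^ 2 = ‖T x‖ ^ 2 := by
    rw [ContinuousLinearMap.apply_norm_sq_eq_inner_adjoint_right,
      ContinuousLinearMap.apply_norm_sq_eq_inner_adjoint_right]
    have h2 : IsSelfAdjoint (CFC.abs T) := (CFC.abs_nonneg T).isSelfAdjoint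
    rw [← ContinuousLinearMap.star_eq_adjoint, ← ContinuousLinearMap.star_eq_adjoint, h2.star_eq]
    have h3 := CFC.abs_mul_abs T
    rw [ContinuousLinearMap.mul_def, ContinuousLinearMap.mul_def] at h3
    rw [h3]
  exact (pow_left_inj₀ (norm_nonneg _) (norm_nonneg _) two_ne_zero).1 h1

/-- The trace norm dominates the operator norm. -/
theorem ofReal_norm_apply_le (b : HilbertBasis ℕ ℂ H) (T : H →L[ℂ] H) (x : H) :
    ENNReal.ofReal ‖T x‖ ≤ traceNorm b T * ENNReal.ofReal ‖x‖ := by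
  set S : H →L[ℂ] H := CFC.sqrt (CFC.abs T) with hS
  have hSS : S * S = CFC.abs T := CFC.sqrt_mul_sqrt_self _ (CFC.abs_nonneg T)
  have hSsym : ∀ u v : H, inner ℂ (S u) v = inner ℂ u (S v) :=
    fun u v => ((CFC.sqrt_nonneg (CFC.abs T)).isSelfAdjoint.isSymmetric u v)
  -- The trace of `|T| = S * S` is the squared Hilbert–Schmidt norm of `S`, which dominates its
  -- squared operator norm; using this twice handles `‖T x‖ = ‖S (S x)‖`.
  have key : ∀ u : H, ENNReal.ofReal (‖S u‖ ^ 2) ≤ traceNorm b T * ENNReal.ofReal (‖u‖ ^ 2) := by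
    intro u
    rw [ofReal_sq_norm_eq_tsum b, traceNorm, ← ENNReal.tsum_mul_right]
    refine ENNReal.tsum_le_tsum fun n => ?_
    have h1 : (inner ℂ (b n) (CFC.abs T (b n))).re = ‖S (b n)‖ ^ 2 := by
      rw [← hSS, mul_apply_eq_comp, ← hSsym]
      exact inner_self_eq_norm_sq (𝕜 := ℂ) _
    rw [h1, ← ENNReal.ofReal_mul (by positivity), ← mul_pow, ← hSsym]
    exact ENNReal.ofReal_le_ofReal
      (pow_le_pow_left₀ (norm_nonneg _) (norm_inner_le_norm _ _) 2)
  have h2 : ENNReal.ofReal ‖T x‖ ^ 2 ≤ (traceNorm b T * ENNReal.ofReal ‖x‖) ^ 2 := by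
    rw [← norm_abs_apply, ← hSS, mul_apply_eq_comp,
      ← ENNReal.ofReal_pow (norm_nonneg _), mul_pow, ← ENNReal.ofReal_pow (norm_nonneg _)]
    calc _ ≤ traceNorm b T * ENNReal.ofReal (‖S x‖ ^ 2) := key _
      _ ≤ traceNorm b T * (traceNorm b T * ENNReal.ofReal (‖x‖ ^ 2)) := by gcongr; exact key _
      _ = _ := by ring
  exact (ENNReal.pow_le_pow_left_iff two_ne_zero).1 h2

/-- Strong convergence is all that the witness argument needs from trace-norm convergence. -/
theorem TraceTendsto.tendsto_apply {b : HilbertBasis ℕ ℂ H} {ξ : ℕ → (H →L[ℂ] H)}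
    {ρ : H →L[ℂ] H} (h : TraceTendsto b ξ ρ) (x : H) :
    Tendsto (fun k => ξ k x) atTop (𝓝 (ρ x)) := by
  rw [tendsto_iff_norm_sub_tendsto_zero]
  have h1 : Tendsto (fun k => traceNorm b (ξ k - ρ) * ENNReal.ofReal ‖x‖) atTop (𝓝 0) := by
    have := ENNReal.Tendsto.mul_const (b := ENNReal.ofReal ‖x‖) h (Or.inr ENNReal.ofReal_ne_top)
    simpa using this
  have h2 : Tendsto (fun k => ENNReal.ofReal ‖ξ k x - ρ x‖) atTop (𝓝 0) :=
    tendsto_of_tendsto_of_tendsto_of_le_of_le tendsto_const_nhds h1 (fun _ => zero_le)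
      fun k => ofReal_norm_apply_le b (ξ k - ρ) x
  have h3 := (ENNReal.tendsto_toReal ENNReal.zero_ne_top).comp h2
  simpa [Function.comp_def, ENNReal.toReal_ofReal (norm_nonneg _)] using h3

theorem proj_apply (η x : H) : proj η x = inner ℂ η x • η := rfl

theorem hasSum_trace_proj (b : HilbertBasis ℕ ℂ H) (η : H) :
    HasSum (fun n => inner ℂ (b n) (proj η (b n))) (inner ℂ η η) := by
  convert! b.hasSum_inner_mul_inner η η using 2
  rw [proj_apply, inner_smul_right]

/-- The trace norm of a difference of two pure states. -/
theorem traceNorm_proj_sub_proj (b : HilbertBasis ℕ ℂ H) {η ψ : H} (hη : ‖η‖ = 1) (hψ : ‖ψ‖ = 1) :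
    traceNorm b (proj η - proj ψ) = ENNReal.ofReal (2 * √(1 - ‖inner ℂ η ψ‖ ^ 2)) := by
  set T := proj η - proj ψ with hT
  set c : ℂ := inner ℂ η ψ with hc
  have hηη : inner ℂ η η = 1 := inner_self_eq_one_of_norm_eq_one hη
  have hψψ : inner ℂ ψ ψ = 1 := inner_self_eq_one_of_norm_eq_one hψ
  have hψη : inner ℂ ψ η = star c := (inner_conj_symm ψ η).symm
  have hcc : c * star c = ((‖c‖ ^ 2 : ℝ) : ℂ) := by
    rw [Complex.star_def, Complex.mul_conj']; push_cast; rfl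
  have hc1 : ‖c‖ ≤ 1 := by simpa [hη, hψ] using norm_inner_le_norm (𝕜 := ℂ) η ψ
  have hd0 : 0 ≤ 1 - ‖c‖ ^ 2 := by nlinarith [norm_nonneg c]
  set d : ℝ := √(1 - ‖c‖ ^ 2) with hd
  have hdd : d * d = 1 - ‖c‖ ^ 2 := Real.mul_self_sqrt hd0
  have hTsa : IsSelfAdjoint T :=
    (InnerProductSpace.isPositive_rankOne_self η).isSelfAdjoint.sub
      (InnerProductSpace.isPositive_rankOne_self ψ).isSelfAdjoint
  have hTT : ∀ x, (T * T) x = inner ℂ η x • η + inner ℂ ψ x • ψ - (c * inner ℂ ψ x) • η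
      - (star c * inner ℂ η x) • ψ := by
    intro x
    simp only [hT, mul_apply_eq_comp, sub_apply, proj_apply,
      inner_sub_right, inner_smul_right, hηη, hψψ, hψη, ← hc]
    module
  have hT3 : T * T * T = (d * d) • T := by
    ext x
    rw [mul_apply_eq_comp, hTT]
    simp only [hT, sub_apply, proj_apply,
      inner_sub_right, inner_smul_right, hηη, hψψ, hψη, ← hc, smul_apply]
    have e : (((d * d : ℝ) : ℂ)) = 1 - c * star c := by rw [hcc, hdd]; push_cast; rfl
    rw [← Complex.coe_smul, e]
    module
  have hTTnonneg : 0 ≤ T * T := by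
    have := star_mul_self_nonneg T
    rwa [hTsa.star_eq] at this
  -- From `T³ = d² T` follows `(T² / d)² = T²`, and `T² / d` is positive, so it is the square root.
  -- If `d = 0` then `T⁴ = 0` forces `T² = 0`, and the value of `d⁻¹` is irrelevant.
  have habs : CFC.abs T = d⁻¹ • (T * T) := by
    rw [CFC.abs, hTsa.star_eq]
    by_cases h0 : d = 0
    · have h4 : T * T = 0 := by
        have h5 : (T * T) * (T * T) = 0 := by
          rw [← mul_assoc, hT3, h0]; simp
        have h6 : star (T * T) * (T * T) = 0 := by
          rwa [hTTnonneg.isSelfAdjoint.star_eq]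
        exact CStarRing.star_mul_self_eq_zero_iff _ |>.1 h6
      rw [h4]; simp
    · refine CFC.sqrt_unique ?_ (smul_nonneg (inv_nonneg.2 (Real.sqrt_nonneg _)) hTTnonneg)
      rw [smul_mul_smul_comm, ← mul_assoc, hT3, smul_mul_assoc, smul_smul]
      rw [show d⁻¹ * d⁻¹ * (d * d) = 1 by field_simp, one_smul]
  have htr : HasSum (fun n => (inner ℂ (b n) (CFC.abs T (b n))).re) (2 * d) := by
    have h1 := (((hasSum_trace_proj b η).add (hasSum_trace_proj b ψ)).sub
      ((b.hasSum_inner_mul_inner ψ η).mul_left c)).sub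
      ((b.hasSum_inner_mul_inner η ψ).mul_left (star c))
    have h2 := Complex.reCLM.hasSum (h1.mul_left ((d⁻¹ : ℝ) : ℂ))
    convert! h2 using 1
    · funext n
      simp only [Complex.reCLM_apply]
      congr 1
      rw [habs, smul_apply, hTT, ← Complex.coe_smul]
      simp only [proj_apply, inner_smul_right, inner_add_right, inner_sub_right]
      ring
    · simp only [Complex.reCLM_apply]
      rw [hηη, hψψ, hψη, ← hc, mul_comm (star c) c, hcc,
        show ((d⁻¹ : ℝ) : ℂ) * (1 + 1 - ((‖c‖ ^ 2 : ℝ) : ℂ) - ((‖c‖ ^ 2 : ℝ) : ℂ))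
          = ((d⁻¹ * (2 * (d * d)) : ℝ) : ℂ) by rw [hdd]; push_cast; ring, Complex.ofReal_re]
      by_cases h0 : d = 0
      · simp [h0]
      · field_simp
  rw [traceNorm, ← htr.tsum_eq, ENNReal.ofReal_tsum_of_nonneg _ htr.summable]
  intro n
  have := (ContinuousLinearMap.nonneg_iff_isPositive _).1 (CFC.abs_nonneg T)
  exact (this.re_inner_nonneg_right (b n))

theorem traceTendsto_proj (b : HilbertBasis ℕ ℂ H) {η : ℕ → H} {ψ : H} (hη : ∀ k, ‖η k‖ = 1)
    (hψ : ‖ψ‖ = 1) (h : Tendsto η atTop (𝓝 ψ)) :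
    TraceTendsto b (fun k => proj (η k)) (proj ψ) := by
  unfold TraceTendsto
  simp_rw [fun k => traceNorm_proj_sub_proj b (hη k) hψ]
  have h1 : Continuous fun x : H => ENNReal.ofReal (2 * √(1 - ‖inner ℂ x ψ‖ ^ 2)) :=
    ENNReal.continuous_ofReal.comp (by fun_prop)
  have h2 := (h1.tendsto ψ).comp h
  convert! h2 using 2
  rw [inner_self_eq_norm_sq_to_K, hψ]
  simp

/-! ### Convex hulls of pure states -/

/-- A convex combination of vectors is dominated by the corresponding mixture. -/
theorem exists_mixture (b : HilbertBasis ℕ ℂ H) {ι : Type*} (f : ι → H) (hf : ∀ i, ‖f i‖ = 1)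
    {v : H} (hv : v ∈ convexHull ℝ (Set.range f)) :
    ∃ σ ∈ convexHull ℝ (Set.range fun i => proj (f i)),
      (σ - proj v).IsPositive ∧ HasSum (fun n => inner ℂ (b n) (σ (b n))) (1 : ℂ) := by
  refine convexHull_min (s := Set.range f) (t := {v | ∃ σ ∈ convexHull ℝ (Set.range fun i =>
    proj (f i)), (σ - proj v).IsPositive ∧ HasSum (fun n => inner ℂ (b n) (σ (b n))) (1 : ℂ)})
    ?_ ?_ hv
  · rintro _ ⟨i, rfl⟩
    refine ⟨proj (f i), subset_convexHull ℝ _ ⟨i, rfl⟩, by simp, ?_⟩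
    have := hasSum_trace_proj b (f i)
    rwa [inner_self_eq_one_of_norm_eq_one (hf i)] at this
  · rintro v ⟨σ, hσ, hσv, hσt⟩ w ⟨τ, hτ, hτw, hτt⟩ p q hp hq hpq
    refine ⟨p • σ + q • τ, convex_convexHull ℝ _ hσ hτ hp hq hpq, ?_, ?_⟩
    -- The variance identity: mixing two points adds the positive cross term `p q |v - w⟩⟨v - w|`.
    · have e : p • σ + q • τ - proj (p • v + q • w) = p • (σ - proj v) + q • (τ - proj w)
          + (p * q) • proj (v - w) := by
        obtain rfl : q = 1 - p := by linarith
        ext x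
        simp only [add_apply, sub_apply,
          smul_apply, proj_apply, ← Complex.coe_smul, inner_add_left,
          inner_sub_left, inner_smul_left, Complex.conj_ofReal]
        push_cast
        module
      rw [e, ← ContinuousLinearMap.nonneg_iff_isPositive]
      rw [← ContinuousLinearMap.nonneg_iff_isPositive] at hσv hτw
      have h3 : 0 ≤ proj (v - w) := (ContinuousLinearMap.nonneg_iff_isPositive _).2
        (InnerProductSpace.isPositive_rankOne_self _)
      exact add_nonneg (add_nonneg (smul_nonneg hp hσv) (smul_nonneg hq hτw))
        (smul_nonneg (mul_nonneg hp hq) h3)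
    · have h3 := (hσt.mul_left (p : ℂ)).add (hτt.mul_left (q : ℂ))
      convert! h3 using 1
      · funext n
        simp only [add_apply, smul_apply,
          ← Complex.coe_smul, inner_add_right, inner_smul_right]
      · rw [mul_one, mul_one, ← Complex.ofReal_add, hpq, Complex.ofReal_one]

theorem subset_traceClosure (b : HilbertBasis ℕ ℂ H) (S : Set (H →L[ℂ] H)) :
    S ⊆ traceClosure b S := by
  intro σ hσ
  refine ⟨fun _ => σ, fun _ => hσ, ?_⟩
  simp [TraceTendsto, traceNorm]

/-- A vector that is `μ^{-1/2}`-proportional to a limit of convex combinations of unit vectors has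
robustness at most `μ`. -/
theorem robustness_le_of_mem_closure (b : HilbertBasis ℕ ℂ H) {ι : Type*} (f : ι → H)
    (hf : ∀ i, ‖f i‖ = 1) {v ζ : H} {s μ : ℝ} (hs : 0 < s) (hμ : s ^ 2 < μ) (hμ1 : 1 < μ)
    (hv : v ∈ closure (convexHull ℝ (Set.range f))) (hζ : ζ = s • v) (hζ1 : ‖ζ‖ = 1) :
    robustness b (traceClosure b (convexHull ℝ (Set.range fun i => proj (f i)))) (proj ζ)
      ≤ ENNReal.ofReal μ := by
  obtain ⟨u, hu, hlim⟩ := mem_closure_iff_seq_limit.1 hv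
  have hv1 : s * ‖v‖ = 1 := by
    rw [hζ, norm_smul, Real.norm_of_nonneg hs.le] at hζ1; exact hζ1
  have hvpos : 0 < ‖v‖ := by by_contra h; nlinarith [norm_nonneg v]
  have hnorm : Tendsto (fun k => ‖u k‖) atTop (𝓝 ‖v‖) := hlim.norm
  have hev : ∀ᶠ k in atTop, 1 < μ * ‖u k‖ ^ 2 := by
    have h1 : Tendsto (fun k => μ * ‖u k‖ ^ 2) atTop (𝓝 (μ * ‖v‖ ^ 2)) :=
      (hnorm.pow 2).const_mul μ
    refine h1.eventually (lt_mem_nhds ?_)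
    calc (1 : ℝ) = s ^ 2 * ‖v‖ ^ 2 := by rw [← mul_pow, hv1, one_pow]
      _ < μ * ‖v‖ ^ 2 := by gcongr
  -- Only a tail of the sequence satisfies `1 < μ ‖u k‖²`, while the definition of robustness
  -- constrains every index; hence the shift by `N`.
  obtain ⟨N, hN⟩ := eventually_atTop.1 hev
  have hN' : ∀ k, 1 < μ * ‖u (k + N)‖ ^ 2 := fun k => hN _ (by omega)
  have hupos : ∀ k, 0 < ‖u (k + N)‖ := by
    intro k
    rcases (norm_nonneg (u (k + N))).eq_or_lt with h | h
    · have := hN' k; rw [← h] at this; norm_num at this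
    · exact h
  choose σ hσ hσpos hσtr using fun k => exists_mixture b f hf (hu (k + N))
  set lam : ℝ≥0 := ⟨μ - 1, by linarith⟩ with hlam
  have hlamR : (lam : ℝ) = μ - 1 := rfl
  have hlam0 : (lam : ℝ) ≠ 0 := by rw [hlamR]; linarith
  set η : ℕ → H := fun k => ‖u (k + N)‖⁻¹ • u (k + N) with hη
  have hη1 : ∀ k, ‖η k‖ = 1 := by
    intro k
    rw [hη, norm_smul, norm_inv, norm_norm, inv_mul_cancel₀ (hupos k).ne']
  have hηlim : Tendsto η atTop (𝓝 ζ) := by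
    have h1 : Tendsto (fun k => ‖u k‖⁻¹ • u k) atTop (𝓝 (‖v‖⁻¹ • v)) :=
      (hnorm.inv₀ hvpos.ne').smul hlim
    have h2 := h1.comp (tendsto_add_atTop_nat N)
    rw [hζ, show s = ‖v‖⁻¹ from eq_inv_of_mul_eq_one_left hv1]
    exact h2
  have hprojη : ∀ k, proj (η k) = (‖u (k + N)‖ ^ 2)⁻¹ • proj (u (k + N)) := by
    intro k
    ext x
    simp only [hη, proj_apply, smul_apply, ← Complex.coe_smul, inner_smul_left,
      Complex.conj_ofReal]
    push_cast
    module
  -- `τ` is chosen so that `ξ + lam τ = μ σ`, with `lam = μ - 1` nonzero because `1 < μ`. It is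
  -- positive since `μ σ - proj η = μ (σ - proj u) + (μ - ‖u‖⁻²) proj u`.
  refine sInf_le ⟨lam, fun k => proj (η k),
    fun k => (lam : ℝ)⁻¹ • (μ • σ k - proj (η k)), ?_, ?_, traceTendsto_proj b hη1 hζ1 hηlim, ?_⟩
  · rw [← ENNReal.ofReal_coe_nnreal, hlamR, ← ENNReal.ofReal_one, ← ENNReal.ofReal_add
      zero_le_one (by linarith)]
    congr 1; ring
  · intro k
    constructor
    · have e : μ • σ k - proj (η k) = μ • (σ k - proj (u (k + N)))
          + (μ - (‖u (k + N)‖ ^ 2)⁻¹) • proj (u (k + N)) := by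
        rw [hprojη]; module
      have h3 : 0 ≤ proj (u (k + N)) := (ContinuousLinearMap.nonneg_iff_isPositive _).2
        (InnerProductSpace.isPositive_rankOne_self _)
      have h4 : 0 ≤ μ - (‖u (k + N)‖ ^ 2)⁻¹ := by
        rw [sub_nonneg, inv_le_iff_one_le_mul₀ (pow_pos (hupos k) 2)]
        exact (hN' k).le
      rw [← ContinuousLinearMap.nonneg_iff_isPositive]
      beta_reduce
      rw [e]
      exact smul_nonneg (inv_nonneg.2 lam.2) (add_nonneg (smul_nonneg (by linarith)
        ((ContinuousLinearMap.nonneg_iff_isPositive _).2 (hσpos k))) (smul_nonneg h4 h3))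
    · have h3 := (((hσtr k).mul_left (μ : ℂ)).sub (hasSum_trace_proj b (η k))).mul_left
        (((lam : ℝ)⁻¹ : ℝ) : ℂ)
      convert! h3 using 1
      · funext n
        simp only [sub_apply, smul_apply,
          ← Complex.coe_smul, inner_sub_right, inner_smul_right]
      · rw [inner_self_eq_one_of_norm_eq_one (hη1 k), mul_one, ← Complex.ofReal_one, ← Complex.ofReal_sub, ← Complex.ofReal_mul, ← hlamR,
          inv_mul_cancel₀ hlam0]
  · intro k
    apply subset_traceClosure
    have h5 : (1 + (lam : ℝ)) = μ := by rw [hlamR]; ring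
    have h6 : μ ≠ 0 := by linarith
    rw [smul_smul, mul_inv_cancel₀ hlam0, one_smul, h5, add_sub_cancel, smul_smul,
      inv_mul_cancel₀ h6, one_smul]
    exact hσ k

/-- A vector `h` whose overlap with every pure state in the family is at most one is a witness:
its overlap with `ζ` bounds the robustness of `ζ` from below. -/
theorem le_robustness_of_witness (b : HilbertBasis ℕ ℂ H) {ι : Type*} (f : ι → H) {h : H}
    (hf : ∀ i, ‖inner ℂ h (f i)‖ ≤ 1) (ζ : H) :
    ENNReal.ofReal (‖inner ℂ h ζ‖ ^ 2) ≤
      robustness b (traceClosure b (convexHull ℝ (Set.range fun i => proj (f i)))) (proj ζ) := by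
  have hproj : ∀ η : H, (inner ℂ h (proj η h)).re = ‖inner ℂ h η‖ ^ 2 := by
    intro η
    rw [proj_apply, inner_smul_right, ← inner_conj_symm η h, Complex.conj_mul',
      ← Complex.ofReal_pow, Complex.ofReal_re]
  have hlim : ∀ {ξ : ℕ → (H →L[ℂ] H)} {ρ : H →L[ℂ] H}, TraceTendsto b ξ ρ →
      Tendsto (fun k => (inner ℂ h (ξ k h)).re) atTop (𝓝 (inner ℂ h (ρ h)).re) := by
    intro ξ ρ hξ
    exact (Complex.continuous_re.tendsto _).comp (tendsto_const_nhds.inner (hξ.tendsto_apply h))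
  have hhull : ∀ σ ∈ convexHull ℝ (Set.range fun i => proj (f i)), (inner ℂ h (σ h)).re ≤ 1 := by
    intro σ hσ
    refine convexHull_min (t := {σ : H →L[ℂ] H | (inner ℂ h (σ h)).re ≤ 1}) ?_ ?_ hσ
    · rintro _ ⟨i, rfl⟩
      simp only [Set.mem_ofPred_eq, hproj]
      exact pow_le_one₀ (norm_nonneg _) (hf i)
    · intro σ hσ τ hτ p q hp hq hpq
      simp only [Set.mem_ofPred_eq, add_apply, smul_apply,
        ← Complex.coe_smul, inner_add_right, inner_smul_right, Complex.add_re,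
        Complex.re_ofReal_mul] at hσ hτ ⊢
      nlinarith
  refine le_sInf ?_
  rintro x ⟨lam, ξ, τ, rfl, hτ, hξ, hfree⟩
  have hk : ∀ k, (inner ℂ h (ξ k h)).re ≤ 1 + lam := by
    intro k
    obtain ⟨c, hc, hcl⟩ := hfree k
    have h1 := le_of_tendsto' (hlim hcl) fun j => hhull _ (hc j)
    have h2 : 0 ≤ (inner ℂ h (τ k h)).re := (hτ k).1.re_inner_nonneg_right h
    have h3 : (0 : ℝ) < 1 + lam := by positivity
    simp only [add_apply, smul_apply,
        ← Complex.coe_smul, inner_add_right, inner_smul_right, Complex.add_re,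
        Complex.re_ofReal_mul] at h1
    rw [inv_mul_le_iff₀ h3] at h1
    nlinarith [mul_nonneg lam.2 h2]
  have h4 := le_of_tendsto' (hlim hξ) hk
  rw [hproj] at h4
  calc _ ≤ ENNReal.ofReal (1 + lam) := ENNReal.ofReal_le_ofReal h4
    _ = _ := by
      rw [ENNReal.ofReal_add zero_le_one (NNReal.coe_nonneg lam), ENNReal.ofReal_one,
        ENNReal.ofReal_coe_nnreal]

/-! ### Orbits of the squeezing generator -/

theorem inner_toFock_annihilation (b : HilbertBasis ℕ ℂ H) (f g : ℕ →₀ ℂ) :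
    inner ℂ (toFock b f) (toFock b (annihilation g)) =
      inner ℂ (toFock b (creation f)) (toFock b g) := by
  induction f using Finsupp.induction_linear with
  | zero => simp
  | add f₁ f₂ h₁ h₂ => simp only [map_add, inner_add_left, h₁, h₂]
  | single m c =>
    induction g using Finsupp.induction_linear with
    | zero => simp
    | add g₁ g₂ h₁ h₂ => simp only [map_add, inner_add_right, h₁, h₂]
    | single n d =>
      simp only [toFock, annihilation, creation, Finsupp.linearCombination_single, map_smul,
        inner_smul_left, inner_smul_right, orthonormal_iff_ite.1 b.orthonormal, Complex.conj_ofReal]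
      -- At `n = 0` the truncated `n - 1` is harmless, its coefficient being `√0`.
      rcases n with _ | n
      · simp
      · by_cases h : m = n
        · subst h; simp; left; ring
        · simp [h]

theorem inner_toFock_creation (b : HilbertBasis ℕ ℂ H) (f g : ℕ →₀ ℂ) :
    inner ℂ (toFock b f) (toFock b (creation g)) =
      inner ℂ (toFock b (annihilation f)) (toFock b g) := by
  rw [← inner_conj_symm, ← inner_toFock_annihilation, inner_conj_symm]

/-- Skew-symmetry holds on finite Fock combinations because `a` and `a†` are mutually adjoint there,
and it is a closed condition on pairs, so it passes to the closure of the graph. -/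
theorem inner_add_inner_of_mem_squeezeGraph {b : HilbertBasis ℕ ℂ H} {p : H × H}
    (hp : p ∈ squeezeGraph b) : inner ℂ p.1 p.2 + inner ℂ p.2 p.1 = 0 := by
  have hcl : IsClosed {p : H × H | inner ℂ p.1 p.2 + inner ℂ p.2 p.1 = 0} :=
    isClosed_eq (by fun_prop) continuous_const
  refine closure_minimal ?_ hcl hp
  rintro _ ⟨f, rfl⟩
  change inner ℂ (toFock b f) (toFock b (squeezeGen f)) +
    inner ℂ (toFock b (squeezeGen f)) (toFock b f) = 0
  simp only [LinearMap.comp_apply, squeezeGen, LinearMap.smul_apply,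
    LinearMap.sub_apply, map_smul, map_sub, inner_smul_left, inner_smul_right, inner_sub_left,
    inner_sub_right, inner_toFock_annihilation, inner_toFock_creation]
  rw [show (starRingEnd ℂ) (1 / 2) = 1 / 2 by simp [Complex.ext_iff]]
  ring

theorem IsExpOrbit.norm_eq {b : HilbertBasis ℕ ℂ H} {v : H} {ψ : ℝ → H}
    (h : IsExpOrbit (squeezeGraph b) v ψ) (t : ℝ) : ‖ψ t‖ = ‖v‖ := by
  have hd : ∀ s, HasDerivAt (fun s => inner ℂ (ψ s) (ψ s)) 0 s := by
    intro s
    obtain ⟨w, hw, hder⟩ := h.2 s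
    have := hder.inner ℂ hder
    rwa [inner_add_inner_of_mem_squeezeGraph hw] at this
  have hc := is_const_of_deriv_eq_zero (fun s => (hd s).differentiableAt) (fun s => (hd s).deriv) t 0
  rw [h.1, inner_self_eq_norm_sq_to_K, inner_self_eq_norm_sq_to_K] at hc
  have hc' : ‖ψ t‖ ^ 2 = ‖v‖ ^ 2 := by exact_mod_cast hc
  exact (pow_left_inj₀ (norm_nonneg _) (norm_nonneg _) two_ne_zero).1 hc'

theorem IsExpOrbit.unique {b : HilbertBasis ℕ ℂ H} {v : H} {ψ χ : ℝ → H}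
    (h : IsExpOrbit (squeezeGraph b) v ψ) (h' : IsExpOrbit (squeezeGraph b) v χ) (t : ℝ) :
    ψ t = χ t := by
  have hd : IsExpOrbit (squeezeGraph b) 0 (fun s => ψ s - χ s) := by
    refine ⟨by simp [h.1, h'.1], fun s => ?_⟩
    obtain ⟨w, hw, hder⟩ := h.2 s
    obtain ⟨w', hw', hder'⟩ := h'.2 s
    exact ⟨w - w', (squeezeGraph b).sub_mem hw hw', hder.sub hder'⟩
  have := hd.norm_eq t
  rwa [norm_zero, norm_eq_zero, sub_eq_zero] at this

/-! ### The Fock expansion of squeezed states -/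

/-- The coefficients `√(2n)! / (2ⁿ n!)` of a squeezed state. -/
def squeezeCoeff (n : ℕ) : ℝ := √((2 * n)! : ℝ) / (2 ^ n * n !)

theorem squeezeCoeff_nonneg (n : ℕ) : 0 ≤ squeezeCoeff n := by unfold squeezeCoeff; positivity

/-- The square of the coefficient is `centralBinom n / 4 ^ n`. The bound makes all series below
converge by geometric comparison for `|z| < 1`. -/
theorem squeezeCoeff_le_one (n : ℕ) : squeezeCoeff n ≤ 1 := by
  rw [squeezeCoeff, div_le_one (by positivity), Real.sqrt_le_left (by positivity)]
  have h := Nat.centralBinom_le_four_pow n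
  have h2 : n.centralBinom * n ! * n ! = (2 * n)! := by
    have := Nat.choose_mul_factorial_mul_factorial (show n ≤ 2 * n by omega)
    rwa [show 2 * n - n = n by omega] at this
  have h3 : (2 * n)! ≤ (2 ^ n * n !) ^ 2 := by
    rw [← h2, mul_pow, ← pow_mul, mul_comm n 2, pow_mul, mul_assoc, ← sq]
    exact Nat.mul_le_mul_right _ h
  exact_mod_cast h3

/-- This recurrence and the next absorb the matrix elements of `a†²` and `a²` between `|2n⟩` and
`|2n + 2⟩`. -/
theorem squeezeCoeff_succ (n : ℕ) :
    (2 * n + 2) * squeezeCoeff (n + 1) = squeezeCoeff n * (√(2 * n + 1) * √(2 * n + 2)) := by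
  have h : √((2 * (n + 1))! : ℝ) = √((2 * n)! : ℝ) * (√(2 * n + 1) * √(2 * n + 2)) := by
    rw [← Real.sqrt_mul (by positivity), ← Real.sqrt_mul (by positivity),
      show 2 * (n + 1) = 2 * n + 1 + 1 by ring, Nat.factorial_succ, Nat.factorial_succ]
    congr 1; push_cast; ring
  rw [squeezeCoeff, squeezeCoeff, h, Nat.factorial_succ]
  push_cast
  field_simp
  ring

theorem squeezeCoeff_succ_mul (n : ℕ) :
    squeezeCoeff (n + 1) * (√(2 * n + 1) * √(2 * n + 2)) = (2 * n + 1) * squeezeCoeff n := by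
  have h := squeezeCoeff_succ n
  have h1 : (√(2 * n + 1) * √(2 * n + 2)) * (√(2 * n + 1) * √(2 * n + 2) : ℝ)
      = (2 * n + 1) * (2 * n + 2) := by
    rw [mul_mul_mul_comm, Real.mul_self_sqrt (by positivity), Real.mul_self_sqrt (by positivity)]
  have h2 : (0 : ℝ) < 2 * n + 2 := by positivity
  apply mul_left_cancel₀ h2.ne'
  rw [← mul_assoc, h, mul_assoc, h1]
  ring

/-- The unnormalised squeezed state `∑ zⁿ √(2n)! / (2ⁿ n!) |2n⟩`. -/
def squeezeSeries (b : HilbertBasis ℕ ℂ H) (z : ℝ) : H :=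
  ∑' n : ℕ, (z ^ n * squeezeCoeff n) • b (2 * n)

/-- The derivative of `squeezeSeries`. -/
def squeezeSeriesDeriv (b : HilbertBasis ℕ ℂ H) (z : ℝ) : H :=
  ∑' n : ℕ, (n * z ^ (n - 1) * squeezeCoeff n) • b (2 * n)

theorem norm_smul_fock_le (b : HilbertBasis ℕ ℂ H) (x : ℝ) (n : ℕ) :
    ‖(x * squeezeCoeff n) • b (2 * n)‖ ≤ |x| := by
  rw [norm_smul, b.orthonormal.1, mul_one, norm_mul, Real.norm_eq_abs,
    Real.norm_of_nonneg (squeezeCoeff_nonneg n)]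
  exact mul_le_of_le_one_right (abs_nonneg x) (squeezeCoeff_le_one n)

theorem summable_mul_pow_pred {x : ℝ} (hx : |x| < 1) : Summable fun n : ℕ => |n * x ^ (n - 1)| := by
  rw [← summable_nat_add_iff 1]
  have h1 := summable_pow_mul_geometric_of_norm_lt_one (R := ℝ) 1 (r := |x|) (by simpa using hx)
  have h2 := summable_pow_mul_geometric_of_norm_lt_one (R := ℝ) 0 (r := |x|) (by simpa using hx)
  refine (h1.add h2).congr fun n => ?_
  rw [abs_mul, abs_pow, Nat.abs_cast, add_tsub_cancel_right]
  push_cast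
  ring

theorem hasSum_squeezeSeries (b : HilbertBasis ℕ ℂ H) {z : ℝ} (hz : |z| < 1) :
    HasSum (fun n : ℕ => (z ^ n * squeezeCoeff n) • b (2 * n)) (squeezeSeries b z) := by
  refine (Summable.of_norm_bounded (summable_geometric_of_lt_one (abs_nonneg z) hz)
    fun n => ?_).hasSum
  rw [← abs_pow]
  exact norm_smul_fock_le b _ n

theorem hasSum_squeezeSeriesDeriv (b : HilbertBasis ℕ ℂ H) {z : ℝ} (hz : |z| < 1) :
    HasSum (fun n : ℕ => (n * z ^ (n - 1) * squeezeCoeff n) • b (2 * n))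
      (squeezeSeriesDeriv b z) :=
  (Summable.of_norm_bounded (summable_mul_pow_pred hz) fun n => norm_smul_fock_le b _ n).hasSum

theorem hasDerivAt_squeezeSeries (b : HilbertBasis ℕ ℂ H) {z : ℝ} (hz : |z| < 1) :
    HasDerivAt (squeezeSeries b) (squeezeSeriesDeriv b z) z := by
  obtain ⟨ρ, hzρ, hρ⟩ := exists_between hz
  have hρ0 : 0 < ρ := (abs_nonneg z).trans_lt hzρ
  refine hasDerivAt_tsum_of_isPreconnected (t := Set.Ioo (-ρ) ρ) (y₀ := z)
    (summable_mul_pow_pred (x := ρ) (by rwa [abs_of_pos hρ0])) isOpen_Ioo isPreconnected_Ioo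
    (fun n y _ => ((hasDerivAt_pow n y).mul_const (squeezeCoeff n)).smul_const (b (2 * n)))
    (fun n y hy => (norm_smul_fock_le b _ n).trans ?_) (abs_lt.1 hzρ)
    (hasSum_squeezeSeries b hz).summable (abs_lt.1 hzρ)
  rw [abs_mul, abs_mul, abs_pow, abs_pow, abs_of_pos hρ0]
  gcongr
  exact (abs_lt.2 hy).le

theorem squeezeGen_single_zero :
    squeezeGen (Finsupp.single 0 1) =
      Finsupp.single 2 (-(1 / 2) * (√(2 * (0 : ℕ) + 1) * √(2 * (0 : ℕ) + 2) : ℝ) : ℂ) := by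
  simp [squeezeGen, annihilation, creation, one_add_one_eq_two]

theorem squeezeGen_single_succ (n : ℕ) :
    squeezeGen (Finsupp.single (2 * (n + 1)) 1) =
      Finsupp.single (2 * n) ((1 / 2) * (√(2 * n + 1) * √(2 * n + 2) : ℝ) : ℂ) -
      Finsupp.single (2 * (n + 1 + 1))
        ((1 / 2) * (√(2 * (n + 1 : ℕ) + 1) * √(2 * (n + 1 : ℕ) + 2) : ℝ) : ℂ) := by
  simp only [squeezeGen, annihilation, creation, LinearMap.smul_apply, LinearMap.sub_apply,
    LinearMap.comp_apply, Finsupp.linearCombination_single, Finsupp.smul_single, smul_eq_mul,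
    one_mul, smul_sub]
  congr 2
  · push_cast
    rw [mul_comm (√(2 * (n : ℝ) + 1) : ℂ)]
    rw [show 2 * (n + 1) - 1 = 2 * n + 1 by omega]
    push_cast
    congr 4
    ring_nf
  · push_cast
    congr 4
    ring

/-- On the series the generator acts as the first-order operator `z / 2 + (z² - 1) d/dz`, which
turns the evolution equation into scalar equations for `z` and a prefactor. -/
theorem squeezeSeries_mem_squeezeGraph (b : HilbertBasis ℕ ℂ H) {z : ℝ} (hz : |z| < 1) :
    (squeezeSeries b z, (z / 2) • squeezeSeries b z + (z ^ 2 - 1) • squeezeSeriesDeriv b z)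
      ∈ squeezeGraph b := by
  have hF := hasSum_squeezeSeries b hz
  have hF' := hasSum_squeezeSeriesDeriv b hz
  -- `D n` and `U n` are the images of the `n`-th term under `a² / 2` and `a†² / 2`; `D 0 = 0` since
  -- `a²` kills the vacuum.
  set D : ℕ → H := fun n => match n with
    | 0 => 0
    | n + 1 => ((1 / 2) * (2 * n + 1) * z ^ (n + 1) * squeezeCoeff n) • b (2 * n) with hD
  set U : ℕ → H := fun n => ((n + 1) * z ^ n * squeezeCoeff (n + 1)) • b (2 * (n + 1)) with hU
  have hDsum : HasSum D ((z / 2) • squeezeSeries b z + z ^ 2 • squeezeSeriesDeriv b z) := by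
    have h1 : HasSum (fun n => D (n + 1))
        ((z / 2) • squeezeSeries b z + z ^ 2 • squeezeSeriesDeriv b z) := by
      convert! (hF.const_smul (z / 2)).add (hF'.const_smul (z ^ 2)) using 1
      funext n
      simp only [hD, smul_smul, ← add_smul]
      congr 1
      rcases n with _ | n
      · simp; left; ring
      · rw [Nat.add_sub_cancel]; push_cast; ring
    have h2 := (hasSum_nat_add_iff 1).1 h1
    simpa [hD] using h2
  have hUsum : HasSum U (squeezeSeriesDeriv b z) := by
    have h1 := (hasSum_nat_add_iff' 1).2 hF'
    simpa [hU] using h1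
  have hterm : ∀ n : ℕ, ((z ^ n * squeezeCoeff n) • b (2 * n), D n - U n) ∈ squeezeGraph b := by
    intro n
    refine Submodule.le_topologicalClosure _
      ⟨((z ^ n * squeezeCoeff n : ℝ) : ℂ) • Finsupp.single (2 * n) 1, ?_⟩
    rw [map_smul]
    change ((_ : ℂ) • toFock b _, (_ : ℂ) • toFock b (squeezeGen _)) = _
    refine Prod.ext ?_ ?_ <;> dsimp only
    · rw [Complex.coe_smul]; simp [toFock]
    · rcases n with _ | n
      · rw [mul_zero, squeezeGen_single_zero]
        simp only [toFock, Finsupp.linearCombination_single, hD, hU, smul_smul, ← Complex.coe_smul]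
        rw [zero_sub, ← neg_smul]
        congr 1
        have := squeezeCoeff_succ 0
        rw [show (-(1 / 2) : ℂ) = ((-(1 / 2) : ℝ) : ℂ) by push_cast; rfl]
        rw [← Complex.ofReal_mul, ← Complex.ofReal_mul, ← Complex.ofReal_neg]
        congr 1
        push_cast at *
        linear_combination (1 / 2) * this
      · rw [squeezeGen_single_succ]
        simp only [toFock, Finsupp.linearCombination_single, map_sub, hD, hU, smul_sub, smul_smul,
          ← Complex.coe_smul]
        have h1 := squeezeCoeff_succ (n + 1)
        have h2 := squeezeCoeff_succ_mul n
        congr 2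
        · rw [show (1 / 2 : ℂ) = ((1 / 2 : ℝ) : ℂ) by push_cast; rfl, ← Complex.ofReal_mul,
            ← Complex.ofReal_mul]
          congr 1
          linear_combination (1 / 2) * z ^ (n + 1) * h2
        · rw [show (1 / 2 : ℂ) = ((1 / 2 : ℝ) : ℂ) by push_cast; rfl, ← Complex.ofReal_mul,
            ← Complex.ofReal_mul]
          congr 1
          push_cast at *
          linear_combination (-1 / 2) * z ^ (n + 1) * h1
  have hsum := hF.prodMk (hDsum.sub hUsum)
  -- Finite partial sums and their images lie in the graph and converge jointly, so closedness
  -- suffices.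
  have hmem := (Submodule.isClosed_topologicalClosure _).mem_of_tendsto hsum
    (Eventually.of_forall fun s => Submodule.sum_mem _ fun n _ => hterm n)
  rw [sub_smul, one_smul, ← add_sub_assoc]
  exact hmem

/-- The squeezed vacuum `(cosh t)^{-1/2} ∑ (-tanh t)ⁿ √(2n)! / (2ⁿ n!) |2n⟩`. -/
def squeezedVacuum (b : HilbertBasis ℕ ℂ H) (t : ℝ) : H :=
  (√(Real.cosh t))⁻¹ • squeezeSeries b (-Real.tanh t)

/-- With `z = -tanh t` and `c = (cosh t)^(-1/2)` one has `z' = z² - 1` and `c' = (z / 2) c`, exactly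
what the action of the generator on the series demands. -/
theorem squeezedVacuum_isExpOrbit (b : HilbertBasis ℕ ℂ H) :
    IsExpOrbit (squeezeGraph b) (b 0) (squeezedVacuum b) := by
  constructor
  · have h : HasSum (fun n : ℕ => ((0 : ℝ) ^ n * squeezeCoeff n) • b (2 * n)) (b 0) := by
      convert! hasSum_single (f := fun n : ℕ => ((0 : ℝ) ^ n * squeezeCoeff n) • b (2 * n)) 0
        fun n hn => by simp [hn]
      simp [squeezeCoeff]
    simp [squeezedVacuum, squeezeSeries, h.tsum_eq]
  · intro t
    have hz : |-Real.tanh t| < 1 := by rw [abs_neg]; exact Real.abs_tanh_lt_one t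
    refine ⟨_, (squeezeGraph b).smul_mem (((√(Real.cosh t))⁻¹ : ℝ) : ℂ)
      (squeezeSeries_mem_squeezeGraph b hz), ?_⟩
    have hc := Real.cosh_pos t
    have h1 : HasDerivAt (fun s => -Real.tanh s) (Real.tanh t ^ 2 - 1) t := by
      have e : (fun s => -Real.tanh s) = fun s => -(Real.sinh s / Real.cosh s) := by
        funext s; rw [Real.tanh_eq_sinh_div_cosh]
      rw [e]
      convert! ((Real.hasDerivAt_sinh t).div (Real.hasDerivAt_cosh t) hc.ne').neg using 1
      rw [Real.tanh_eq_sinh_div_cosh]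
      field_simp
      ring
    have h2 : HasDerivAt (fun s => (√(Real.cosh s))⁻¹)
        ((√(Real.cosh t))⁻¹ * (-Real.tanh t / 2)) t := by
      convert! ((Real.hasDerivAt_cosh t).sqrt hc.ne').inv (Real.sqrt_ne_zero'.2 hc) using 1
      rw [Real.sq_sqrt hc.le, Real.tanh_eq_sinh_div_cosh]
      field_simp
    have h3 := h2.smul ((hasDerivAt_squeezeSeries b hz).scomp t h1)
    convert! h3 using 1
    simp only [Complex.coe_smul, Function.comp_apply, neg_sq]
    module

/-! ### Coherent states -/

theorem inner_fock_coherent (b : HilbertBasis ℕ ℂ H) (α : ℂ) (n : ℕ) :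
    inner ℂ (b n) (coherent b α) = coherentCoeff α n := by
  rw [← b.repr_apply_apply, coherent, LinearIsometryEquiv.apply_symm_apply]

theorem norm_coherent (b : HilbertBasis ℕ ℂ H) (α : ℂ) : ‖coherent b α‖ = 1 := by
  have h1 := b.hasSum_inner_mul_inner (coherent b α) (coherent b α)
  have h2 : HasSum (fun n : ℕ => Real.exp (-‖α‖ ^ 2) * ((‖α‖ ^ 2) ^ n / n !)) 1 := by
    have := (NormedSpace.expSeries_div_hasSum_exp (‖α‖ ^ 2)).mul_left (Real.exp (-‖α‖ ^ 2))
    rwa [← Real.exp_eq_exp_ℝ, ← Real.exp_add, neg_add_cancel, Real.exp_zero] at this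
  have h3 := Complex.hasSum_ofReal.2 h2
  have h4 : inner ℂ (coherent b α) (coherent b α) = ((1 : ℝ) : ℂ) := by
    refine h1.unique ?_
    convert! h3 using 1
    funext n
    rw [← inner_conj_symm, inner_fock_coherent, Complex.conj_mul', ← Complex.ofReal_pow]
    congr 1
    rw [coherentCoeff, norm_mul, norm_div, norm_pow, Complex.norm_real, Complex.norm_real,
      Real.norm_eq_abs, Real.abs_exp, Real.norm_of_nonneg (Real.sqrt_nonneg _), mul_pow, div_pow,
      Real.sq_sqrt (by positivity), ← Real.exp_nat_mul]
    congr 1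
    · congr 1; push_cast; ring
    · ring
  have h5 : ‖coherent b α‖ ^ 2 = 1 := by
    rw [← inner_self_eq_norm_sq (𝕜 := ℂ), h4]
    simp
  exact (pow_eq_one_iff_of_nonneg (norm_nonneg _) two_ne_zero).1 h5

/-- The factors `√(2n)!` of the two expansions cancel, leaving an exponential series. -/
theorem inner_coherent_squeezeSeries (b : HilbertBasis ℕ ℂ H) (α : ℂ) {z : ℝ} (hz : |z| < 1) :
    inner ℂ (coherent b α) (squeezeSeries b z) =
      (Real.exp (-‖α‖ ^ 2 / 2) : ℂ) * Complex.exp (z * (starRingEnd ℂ α) ^ 2 / 2) := by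
  have h1 := (innerSL ℂ (coherent b α)).hasSum (hasSum_squeezeSeries b hz)
  have h2 := (NormedSpace.expSeries_div_hasSum_exp
    (z * (starRingEnd ℂ α) ^ 2 / 2)).mul_left (Real.exp (-‖α‖ ^ 2 / 2) : ℂ)
  rw [← Complex.exp_eq_exp_ℂ] at h2
  refine h1.unique ?_
  convert! h2 using 1
  funext n
  have h3 : (√((2 * n)! : ℝ) : ℂ) ≠ 0 := by
    rw [Complex.ofReal_ne_zero]; positivity
  have h4 : (n ! : ℂ) ≠ 0 := by exact_mod_cast n.factorial_ne_zero
  simp only [innerSL_apply_apply, ← Complex.coe_smul, inner_smul_right]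
  rw [← inner_conj_symm, inner_fock_coherent, coherentCoeff, squeezeCoeff]
  simp only [map_mul, map_div₀, map_pow, Complex.conj_ofReal]
  push_cast
  rw [div_pow, mul_pow, ← pow_mul]
  field_simp

/-- The modulus is the exponential of `(-‖α‖² + Re (z ᾱ²)) / 2`, which is nonpositive for `|z| < 1`.
-/
theorem norm_inner_squeezeSeries_coherent_le (b : HilbertBasis ℕ ℂ H) (α : ℂ) {z : ℝ}
    (hz : |z| < 1) : ‖inner ℂ (squeezeSeries b z) (coherent b α)‖ ≤ 1 := by
  rw [norm_inner_symm, inner_coherent_squeezeSeries b α hz, norm_mul, Complex.norm_real,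
    Real.norm_eq_abs, Real.abs_exp, Complex.norm_exp, ← Real.exp_add, Real.exp_le_one_iff]
  have h1 := (Complex.re_le_norm (z * (starRingEnd ℂ α) ^ 2 / 2))
  rw [norm_div, norm_mul, norm_pow, Complex.norm_real, RCLike.norm_conj, Complex.norm_ofNat,
    Real.norm_eq_abs] at h1
  nlinarith [mul_le_mul_of_nonneg_right hz.le (sq_nonneg ‖α‖)]

theorem continuous_coherentCoeff (n : ℕ) : Continuous fun α => coherentCoeff α n := by
  unfold coherentCoeff
  fun_prop

theorem stronglyMeasurable_coherent (b : HilbertBasis ℕ ℂ H) :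
    StronglyMeasurable (coherent b) := by
  refine stronglyMeasurable_of_tendsto atTop
    (f := fun (N : ℕ) α => ∑ n ∈ Finset.range N, coherentCoeff α n • b n) (fun N => ?_) ?_
  · exact (continuous_finsetSum _ fun n _ =>
      (continuous_coherentCoeff n).smul continuous_const).stronglyMeasurable
  · rw [tendsto_pi_nhds]
    intro α
    have := (b.hasSum_repr (coherent b α)).tendsto_sum_nat
    simpa only [b.repr_apply_apply, inner_fock_coherent] using this

theorem integrable_coherent (b : HilbertBasis ℕ ℂ H) {Ω : Type*} [MeasurableSpace Ω]
    {μ : Measure Ω} [IsFiniteMeasure μ] {f : Ω → ℂ} (hf : Measurable f) :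
    Integrable (fun x => coherent b (f x)) μ :=
  Integrable.of_bound ((stronglyMeasurable_coherent b).comp_measurable hf).aestronglyMeasurable 1
    (Eventually.of_forall fun _ => (norm_coherent b _).le)

/-! ### Gaussian moments -/

theorem Gamma_nat_add_half_eq_factorial (n : ℕ) :
    Real.Gamma (n + 1 / 2) = (2 * n)! / (4 ^ n * n !) * √Real.pi := by
  induction n with
  | zero =>
    rw [Nat.cast_zero, zero_add, Real.Gamma_one_half_eq]
    simp
  | succ n ih =>
    rw [show ((n + 1 : ℕ) : ℝ) + 1 / 2 = (n + 1 / 2) + 1 by push_cast; ring,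
      Real.Gamma_add_one (by positivity), ih, show 2 * (n + 1) = 2 * n + 1 + 1 by ring,
      Nat.factorial_succ, Nat.factorial_succ, Nat.factorial_succ]
    push_cast
    field_simp
    ring

theorem integral_even_pow_mul_exp_neg_mul_sq (n : ℕ) {a : ℝ} (ha : 0 < a) :
    ∫ x : ℝ, x ^ (2 * n) * Real.exp (-a * x ^ 2) =
      (a ^ n)⁻¹ * (√a)⁻¹ * ((2 * n)! / (4 ^ n * n !) * √Real.pi) := by
  have h1 : ∫ x : ℝ, x ^ (2 * n) * Real.exp (-a * x ^ 2) =
      2 * ∫ x in Set.Ioi (0 : ℝ), x ^ (2 * n) * Real.exp (-a * x ^ 2) := by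
    rw [← integral_comp_abs]
    simp only [pow_mul, sq_abs]
  have h2 := integral_rpow_mul_exp_neg_mul_rpow (p := 2) (q := (2 * n : ℕ)) (b := a)
    two_pos (lt_of_lt_of_le (by norm_num) (Nat.cast_nonneg _)) ha
  simp only [Real.rpow_natCast, Real.rpow_two] at h2
  rw [h1, h2, show (((2 * n : ℕ) : ℝ) + 1) / 2 = n + 1 / 2 by push_cast; ring,
    Gamma_nat_add_half_eq_factorial,
    show -(((2 * n : ℕ) : ℝ) + 1) / 2 = -(n : ℝ) + -(1 / 2) by push_cast; ring,
    Real.rpow_add ha, Real.rpow_neg ha.le, Real.rpow_neg ha.le, Real.rpow_natCast,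
    ← Real.sqrt_eq_rpow]
  ring

/-- The damping `κ` is `s²` when Fock coefficients of the Gaussian average are computed, and `s² (1
- t)` when it is paired with the witness. -/
theorem integral_gaussianReal_even_pow (n : ℕ) {κ : ℝ} (hκ : 0 ≤ κ) :
    ∫ x, x ^ (2 * n) * Real.exp (-κ * x ^ 2 / 2) ∂(gaussianReal 0 1) =
      (√(1 + κ))⁻¹ * ((1 + κ) ^ n)⁻¹ * ((2 * n)! / (2 ^ n * n !)) := by
  rw [integral_gaussianReal_eq_integral_smul one_ne_zero]
  have h1 : ∀ x : ℝ, gaussianPDFReal 0 1 x • (x ^ (2 * n) * Real.exp (-κ * x ^ 2 / 2)) =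
      (√(2 * Real.pi))⁻¹ * (x ^ (2 * n) * Real.exp (-((1 + κ) / 2) * x ^ 2)) := by
    intro x
    have h2 : Real.exp (-((1 + κ) / 2) * x ^ 2) =
        Real.exp (-(x - 0) ^ 2 / (2 * ((1 : ℝ≥0) : ℝ))) * Real.exp (-κ * x ^ 2 / 2) := by
      rw [← Real.exp_add]; congr 1; push_cast; ring
    rw [h2, gaussianPDFReal, smul_eq_mul]
    push_cast
    rw [mul_one]
    ring
  have hpos : 0 < 1 + κ := by linarith
  simp_rw [h1]
  rw [integral_const_mul, integral_even_pow_mul_exp_neg_mul_sq n (by positivity),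
    Real.sqrt_mul (by norm_num), Real.sqrt_div hpos.le, div_pow,
    show (4 : ℝ) ^ n = 2 ^ n * 2 ^ n by rw [← mul_pow]; norm_num]
  have h3 : √Real.pi ≠ 0 := by positivity
  have h4 : √(1 + κ) ≠ 0 := by positivity
  have h5 : √(2 : ℝ) ≠ 0 := by positivity
  field_simp

theorem integral_gaussianReal_odd {f : ℝ → ℂ} (hf : ∀ x, f (-x) = -f x) :
    ∫ x, f x ∂(gaussianReal 0 1) = 0 := by
  have h1 : ∫ x, f x ∂((gaussianReal 0 1).map fun x => -x) = ∫ x, f (-x) ∂(gaussianReal 0 1) :=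
    (Homeomorph.neg ℝ).measurableEmbedding.integral_map f
  rw [gaussianReal_map_neg, neg_zero] at h1
  simp_rw [hf] at h1
  rw [integral_neg] at h1
  linear_combination h1 / 2

/-! ### Squeezed states as Gaussian superpositions of coherent states -/

theorem inner_fock_even_squeezeSeries (b : HilbertBasis ℕ ℂ H) {z : ℝ} (hz : |z| < 1) (n : ℕ) :
    inner ℂ (b (2 * n)) (squeezeSeries b z) = ((z ^ n * squeezeCoeff n : ℝ) : ℂ) := by
  have h1 := (innerSL ℂ (b (2 * n))).hasSum (hasSum_squeezeSeries b hz)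
  refine h1.unique ?_
  have h2 : ∀ m, innerSL ℂ (b (2 * n)) ((z ^ m * squeezeCoeff m) • b (2 * m)) =
      if n = m then ((z ^ m * squeezeCoeff m : ℝ) : ℂ) else 0 := by
    intro m
    rw [innerSL_apply_apply, ← Complex.coe_smul, inner_smul_right,
      orthonormal_iff_ite.1 b.orthonormal]
    simp
  simp_rw [h2]
  convert! hasSum_single n fun m hm => if_neg hm.symm using 1
  rw [if_pos rfl]

theorem inner_fock_odd_squeezeSeries (b : HilbertBasis ℕ ℂ H) {z : ℝ} (hz : |z| < 1) (n : ℕ) :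
    inner ℂ (b (2 * n + 1)) (squeezeSeries b z) = 0 := by
  have h1 := (innerSL ℂ (b (2 * n + 1))).hasSum (hasSum_squeezeSeries b hz)
  refine h1.unique ?_
  convert! hasSum_zero using 1
  funext m
  have : 2 * n + 1 ≠ 2 * m := by omega
  simp [← Complex.coe_smul, orthonormal_iff_ite.1 b.orthonormal, this]

/-- The Gaussian superposition of the coherent states `|i s x⟩` is a squeezed state. -/
theorem integral_coherent_gaussian (b : HilbertBasis ℕ ℂ H) (s : ℝ) :
    ∫ x : ℝ, coherent b (Complex.I * (s * x : ℝ)) ∂(gaussianReal 0 1) =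
      (√(1 + s ^ 2))⁻¹ • squeezeSeries b (-(s ^ 2 / (1 + s ^ 2))) := by
  have hpos : (0 : ℝ) < 1 + s ^ 2 := by positivity
  have hz : |-(s ^ 2 / (1 + s ^ 2))| < 1 := by
    rw [abs_neg, abs_of_nonneg (by positivity), div_lt_one hpos]
    linarith
  have hint : Integrable (fun x : ℝ => coherent b (Complex.I * (s * x : ℝ))) (gaussianReal 0 1) :=
    integrable_coherent b (by fun_prop)
  have hcoeff : ∀ (m : ℕ) (x : ℝ), coherentCoeff (Complex.I * (s * x : ℝ)) m =
      (Complex.I ^ m * s ^ m / √(m ! : ℝ)) * ((x ^ m * Real.exp (-s ^ 2 * x ^ 2 / 2) : ℝ) : ℂ) := by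
    intro m x
    rw [coherentCoeff, norm_mul, Complex.norm_I, one_mul, Complex.norm_real, Real.norm_eq_abs,
      sq_abs, mul_pow, mul_pow, ← neg_mul]
    push_cast
    ring
  apply b.repr.injective
  ext m
  rw [b.repr_apply_apply, b.repr_apply_apply, ← integral_inner hint, ← Complex.coe_smul,
    inner_smul_right]
  simp_rw [inner_fock_coherent, hcoeff]
  rw [integral_const_mul]
  rcases Nat.even_or_odd' m with ⟨n, rfl | rfl⟩
  · rw [inner_fock_even_squeezeSeries b hz, integral_complex_ofReal,
      integral_gaussianReal_even_pow n (sq_nonneg s), pow_mul Complex.I, Complex.I_sq,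
      squeezeCoeff]
    rw [← Complex.ofReal_one, ← Complex.ofReal_neg]
    simp only [← Complex.ofReal_mul, ← Complex.ofReal_pow, ← Complex.ofReal_div]
    congr 1
    have h3 : √((2 * n)! : ℝ) ≠ 0 := by positivity
    have h4 : ((2 * n)! : ℝ) = √((2 * n)! : ℝ) * √((2 * n)! : ℝ) :=
      (Real.mul_self_sqrt (by positivity)).symm
    rw [neg_pow (s ^ 2 / (1 + s ^ 2)), div_pow, pow_mul s]
    nth_rewrite 2 [h4]
    field_simp
  · rw [inner_fock_odd_squeezeSeries b hz, integral_gaussianReal_odd, mul_zero, mul_zero]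
    intro x
    rw [(odd_two_mul_add_one n).neg_pow, neg_sq]
    push_cast
    ring

/-- On the imaginary axis the overlap is `exp (-(1 - t) s² x² / 2)`, which approaches its upper
bound one as `t → 1`. -/
theorem inner_squeezeSeries_integral_coherent (b : HilbertBasis ℕ ℂ H) (s : ℝ) {t : ℝ}
    (ht : |t| < 1) :
    inner ℂ (squeezeSeries b (-t))
      (∫ x : ℝ, coherent b (Complex.I * (s * x : ℝ)) ∂(gaussianReal 0 1)) =
      (((√(1 + s ^ 2 * (1 - t)))⁻¹ : ℝ) : ℂ) := by
  have hint : Integrable (fun x : ℝ => coherent b (Complex.I * (s * x : ℝ))) (gaussianReal 0 1) :=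
    integrable_coherent b (by fun_prop)
  have h0 : 0 ≤ s ^ 2 * (1 - t) := mul_nonneg (sq_nonneg s) (by linarith [(abs_lt.1 ht).2])
  have h1 := integral_gaussianReal_even_pow 0 h0
  rw [← integral_inner hint]
  have h2 : ∀ x : ℝ, inner ℂ (squeezeSeries b (-t)) (coherent b (Complex.I * (s * x : ℝ))) =
      ((x ^ (2 * 0) * Real.exp (-(s ^ 2 * (1 - t)) * x ^ 2 / 2) : ℝ) : ℂ) := by
    intro x
    rw [← inner_conj_symm, inner_coherent_squeezeSeries b _ (by rwa [abs_neg]), map_mul,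
      Complex.conj_ofReal, ← Complex.exp_conj, norm_mul, Complex.norm_I, one_mul,
      Complex.norm_real, Real.norm_eq_abs, sq_abs, mul_zero, pow_zero, one_mul]
    simp only [map_mul, map_div₀, map_pow, Complex.conj_conj, Complex.conj_ofReal]
    rw [show (starRingEnd ℂ) 2 = 2 by simp [Complex.ext_iff], mul_pow Complex.I, Complex.I_sq,
      Complex.ofReal_exp, Complex.ofReal_exp, ← Complex.exp_add]
    congr 1
    push_cast
    ring
  simp_rw [h2]
  rw [integral_complex_ofReal, h1]
  simp

/-! ### Robustness of squeezed states -/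

/-- The value of `s²` is forced by `s² / (1 + s²) = tanh r`; then `1 + s² = exp r * cosh r`, and the
prefactor `exp (r / 2)` restores the normalisation. -/
theorem squeezedVacuum_eq_integral (b : HilbertBasis ℕ ℂ H) {r : ℝ} (hr : 0 ≤ r) :
    squeezedVacuum b r = Real.exp (r / 2) •
      ∫ x : ℝ, coherent b (Complex.I * (√((Real.exp r ^ 2 - 1) / 2) * x : ℝ))
        ∂(gaussianReal 0 1) := by
  have he : 1 ≤ Real.exp r := Real.one_le_exp hr
  have hw : 0 ≤ (Real.exp r ^ 2 - 1) / 2 := by nlinarith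
  have hE : 0 < Real.exp r := Real.exp_pos r
  have hcosh : 1 + (Real.exp r ^ 2 - 1) / 2 = Real.exp r * Real.cosh r := by
    rw [Real.cosh_eq, Real.exp_neg]; field_simp; ring
  have htanh : (Real.exp r ^ 2 - 1) / 2 / (Real.exp r * Real.cosh r) = Real.tanh r := by
    rw [Real.tanh_eq_sinh_div_cosh, Real.sinh_eq, Real.exp_neg]
    have := Real.cosh_pos r
    field_simp
  rw [integral_coherent_gaussian, Real.sq_sqrt hw, hcosh, htanh, smul_smul, squeezedVacuum,
    Real.sqrt_mul hE.le, Real.exp_half]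
  congr 1
  have : √(Real.exp r) ≠ 0 := by positivity
  field_simp

theorem robustness_squeezedVacuum_le (b : HilbertBasis ℕ ℂ H) {r : ℝ} (hr : 0 ≤ r) :
    robustness b (classicalStates b) (proj (squeezedVacuum b r)) ≤
      ENNReal.ofReal (Real.exp r) := by
  have hlim : Tendsto ENNReal.ofReal (𝓝[>] Real.exp r) (𝓝 (ENNReal.ofReal (Real.exp r))) :=
    (ENNReal.continuous_ofReal.tendsto _).mono_left nhdsWithin_le_nhds
  -- The bound is proved for each `μ > exp r`: the strict gap absorbs the norm error of the
  -- approximants and keeps `lam` positive even at `r = 0`.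
  refine ge_of_tendsto hlim (eventually_mem_nhdsWithin.mono fun μ hμ => ?_)
  have hμ' : Real.exp r < μ := hμ
  refine robustness_le_of_mem_closure b (coherent b) (norm_coherent b) (Real.exp_pos (r / 2)) ?_
    ((Real.one_le_exp hr).trans_lt hμ') ?_ (squeezedVacuum_eq_integral b hr) ?_
  · rwa [← Real.exp_nat_mul, show ((2 : ℕ) : ℝ) * (r / 2) = r by push_cast; ring]
  -- A Bochner average over a probability measure stays in a closed convex set, which replaces any
  -- discretisation of the integral.
  · exact (convex_convexHull ℝ _).closure.integral_mem isClosed_closure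
      (Eventually.of_forall fun x => subset_closure (subset_convexHull ℝ _ ⟨_, rfl⟩))
      (integrable_coherent b (by fun_prop))
  · rw [(squeezedVacuum_isExpOrbit b).norm_eq, b.orthonormal.1]

theorem le_robustness_squeezedVacuum (b : HilbertBasis ℕ ℂ H) {r : ℝ} (hr : 0 ≤ r) :
    ENNReal.ofReal (Real.exp r) ≤
      robustness b (classicalStates b) (proj (squeezedVacuum b r)) := by
  set w : ℝ := (Real.exp r ^ 2 - 1) / 2 with hwdef
  have hw : 0 ≤ w := by
    have := Real.one_le_exp hr
    rw [hwdef]; nlinarith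
  have hcont : Tendsto (fun t : ℝ => ENNReal.ofReal ((Real.exp (r / 2) *
      (√(1 + w * (1 - t)))⁻¹) ^ 2)) (𝓝[<] 1) (𝓝 (ENNReal.ofReal (Real.exp r))) := by
    have h1 : ContinuousAt (fun t : ℝ => (Real.exp (r / 2) * (√(1 + w * (1 - t)))⁻¹) ^ 2) 1 := by
      refine ((ContinuousAt.inv₀ (by fun_prop) ?_).const_mul _).pow 2
      simp
    have h2 : Real.exp r = (Real.exp (r / 2) * (√(1 + w * (1 - (1 : ℝ))))⁻¹) ^ 2 := by
      rw [sub_self, mul_zero, add_zero, Real.sqrt_one, inv_one, mul_one, ← Real.exp_nat_mul]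
      congr 1; push_cast; ring
    rw [h2]
    exact (ENNReal.continuous_ofReal.tendsto _).comp (h1.tendsto.mono_left nhdsWithin_le_nhds)
  -- The optimal witness would be `t = 1`, where the series is no longer normalisable, so it is
  -- approached from below.
  refine le_of_tendsto hcont ?_
  filter_upwards [Ioo_mem_nhdsLT (show (0 : ℝ) < 1 by norm_num)] with t ht
  have ht1 : |t| < 1 := by rw [abs_of_pos ht.1]; exact ht.2
  have h := le_robustness_of_witness b (coherent b) (h := squeezeSeries b (-t))
    (fun α => norm_inner_squeezeSeries_coherent_le b α (by rwa [abs_neg])) (squeezedVacuum b r)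
  rw [squeezedVacuum_eq_integral b hr, ← Complex.coe_smul, inner_smul_right,
    inner_squeezeSeries_integral_coherent b _ ht1, Real.sq_sqrt hw, ← Complex.ofReal_mul,
    Complex.norm_real, Real.norm_eq_abs, sq_abs, Complex.coe_smul,
    ← squeezedVacuum_eq_integral b hr] at h
  exact h

theorem isSqueezedVacuum_iff (b : HilbertBasis ℕ ℂ H) (r : ℝ) (ζ : H) :
    IsSqueezedVacuum b r ζ ↔ ζ = squeezedVacuum b r := by
  constructor
  · rintro ⟨ψ, hψ, rfl⟩
    exact hψ.unique (squeezedVacuum_isExpOrbit b) r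
  · rintro rfl
    exact ⟨_, squeezedVacuum_isExpOrbit b, rfl⟩

end SqueezedRobustness

end

theorem mainTheorem7 {H : Type*} [NormedAddCommGroup H] [InnerProductSpace ℂ H] [CompleteSpace H]
    (b : HilbertBasis ℕ ℂ H) (r : ℝ) (hr : 0 ≤ r) :
    (∃! ζ : H, SqueezedRobustness.IsSqueezedVacuum b r ζ) ∧
      ∀ ζ : H, SqueezedRobustness.IsSqueezedVacuum b r ζ →
        SqueezedRobustness.robustness b (SqueezedRobustness.classicalStates b)
          (SqueezedRobustness.proj ζ) = ENNReal.ofReal (Real.exp r) := by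
  simp only [SqueezedRobustness.isSqueezedVacuum_iff]
  refine ⟨existsUnique_eq, ?_⟩
  rintro _ rfl
  exact le_antisymm (SqueezedRobustness.robustness_squeezedVacuum_le b hr)
    (SqueezedRobustness.le_robustness_squeezedVacuum b hr)
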